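/- Let $D$ be a division ring. Polynomials over $D$ are taken in central indeterminates, so every $p\in D[x]$ is written $p=\sum_k a_kx^k$ with $a_k\in D$, and a right root of $p$ in $D$ is an element $a\in D$ with $\sum_k a_ka^k=0$. A division ring is called right algebraically closed if every nonconstant polynomial in one central indeterminate over it has a right root in it. Suppose that $D$ is right algebraically closed. Then the following statements are equivalent: 1. $D$ is a Nullstellensatz ring: for every $n$, a left ideal of $R_n=D[x_1,\dots,x_n]$ is maximal if and only if it is of the form $R_n(x_1-a_1)+\cdots+R_n(x_n-a_n)$ for some $(a_1,\dots,a_n)\in D^n$ with $a_ia_j=a_ja_i$ for all $i,j$. 2. $D$ is an Amitsur–Small ring: for every $n$, every maximal left ideal $I$ of $D[x_1,\dots,x_n]$ and every $m<n$, the left ideal $I\cap D[x_1,\dots,x_m]$ of $D[x_1,\dots,x_m]$ is maximal. 3. $D$ is centrally algebraically closed: for every $n$ and every $(a_1,\dots,a_n)\in D^n$ with $a_ia_j=a_ja_i$ for all $i,j$, the centralizer of $\{a_1,\dots,a_n\}$ in $D$, which is a division ring, is right algebraically closed. -/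

import Mathlib

open Polynomial

/-- A division ring (more generally a ring) `D` is right algebraically closed if every nonconstant
polynomial over `D` in a central indeterminate has a right root in `D`. Here `IsRoot` refers to
the left evaluation `p(a) = ∑ aₖ * a ^ k`, with the coefficients on the left. -/
def IsRightAC (D : Type*) [DivisionRing D] : Prop :=
  ∀ p : D[X], 0 < p.natDegree → ∃ a : D, p.IsRoot a

/-- The centralizer in a division ring `D` of a subset, as a division subring of `D`
(`Subfield` does not require commutativity). -/
def divisionCentralizer {D : Type*} [DivisionRing D] (s : Set D) : Subfield D :=
  { Subring.centralizer s with
    inv_mem' := fun a ha => by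
      have h : a ∈ Set.centralizer s := ha
      exact Set.inv_mem_centralizer₀ h }

/-- `D` is centrally algebraically closed: for every tuple with pairwise commuting
components, the centralizer of the tuple is right algebraically closed. -/
def IsCentrallyAC (D : Type*) [DivisionRing D] : Prop :=
  ∀ (n : ℕ) (a : Fin n → D), (∀ i j, Commute (a i) (a j)) →
    IsRightAC (divisionCentralizer (Set.range a))

/-- The ring `D[x₁, …, xₙ]` of polynomials over `D` in `n` central indeterminates. -/
abbrev CentralPoly (D : Type*) [DivisionRing D] (n : ℕ) : Type _ :=
  AddMonoidAlgebra D (Fin n →₀ ℕ)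

namespace CentralPoly

variable {D : Type*} [DivisionRing D]

/-- The constant polynomial `a`. -/
noncomputable def const {n : ℕ} (a : D) : CentralPoly D n :=
  AddMonoidAlgebra.single 0 a

/-- The indeterminate `xᵢ`. -/
noncomputable def var (D : Type*) [DivisionRing D] {n : ℕ} (i : Fin n) : CentralPoly D n :=
  AddMonoidAlgebra.single (Finsupp.single i 1) 1

/-- The left ideal generated by `x₁ - a₁, …, xₙ - aₙ`. -/
noncomputable def pointIdeal {n : ℕ} (a : Fin n → D) : Ideal (CentralPoly D n) :=
  Ideal.span (Set.range fun i => var D i - const (a i))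

/-- The inclusion `D[x₁, …, xₘ] → D[x₁, …, xₙ]` for `m ≤ n`, fixing `D` and each `xᵢ`, `i ≤ m`. -/
noncomputable def incl (D : Type*) [DivisionRing D] {m n : ℕ} (h : m ≤ n) :
    CentralPoly D m →+* CentralPoly D n :=
  AddMonoidAlgebra.mapDomainRingHom D (Finsupp.mapDomain.addMonoidHom (Fin.castLE h))

end CentralPoly

/-- `D` is a Nullstellensatz ring: for every `n`, the maximal left ideals of `D[x₁, …, xₙ]` are
exactly the left ideals generated by `x₁ - a₁, …, xₙ - aₙ` for a point `a` with pairwise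
commuting components. (`Ideal` means left ideal; the case `n = 0` holds for every `D`.) -/
def IsNullstellensatzRing (D : Type*) [DivisionRing D] : Prop :=
  ∀ (n : ℕ) (I : Ideal (CentralPoly D n)),
    I.IsMaximal ↔
      ∃ a : Fin n → D, (∀ i j, Commute (a i) (a j)) ∧ I = CentralPoly.pointIdeal a

/-- `D` is an Amitsur–Small ring: for every maximal left ideal `I` of `D[x₁, …, xₙ]` and every
`m < n`, the left ideal `I ∩ D[x₁, …, xₘ]` of `D[x₁, …, xₘ]` is maximal. -/
def IsAmitsurSmallRing (D : Type*) [DivisionRing D] : Prop :=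
  ∀ (n : ℕ) (I : Ideal (CentralPoly D n)), I.IsMaximal →
    ∀ (m : ℕ) (h : m < n), (I.comap (CentralPoly.incl D h.le)).IsMaximal

/-! ### Left ideals of `D[X]` and their finite-dimensional quotients. -/

section OneVariable

variable {D : Type*} [DivisionRing D]

/-! A point ideal has quotient of dimension one over `D`, so it is maximal; conversely a proper left
ideal containing some `xᵢ - cᵢ` for every `i` is a point ideal, because the commutator of two such
elements is the constant `cᵢcⱼ - cⱼcᵢ`, which must vanish. Hence 1 asks only that each maximal `I`
contain an `xᵢ - cᵢ` for every `i`.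

1 ⇒ 2: contracting a point ideal gives a proper left ideal containing the truncated point ideal. 2 ⇒
1: after a permutation of the variables, contract `I` to one variable, where right algebraic
closedness supplies `x - c`.

1 ⇒ 3: let `p` have coefficients in the centralizer of `a`. Evaluating `x₀` at `X` and the other
variables at `a` pulls the left ideal `D[X]p` back to a proper left ideal. A point ideal above it
has coordinates `(c₀, a)`, with `p(c₀) = 0` and `c₀` commuting with `a`.

3 ⇒ 1: the simple module `D[x₁, …, xₙ]/I` is a `D`-space with an irreducible commuting family of
operators, and it must be shown to be a line (`IsCentrallyAC.exists_forall_eq_smul`). Every vector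
is torsion for the first operator (`exists_evalEnd_eq_zero`, by generic freeness), so that operator
has an eigenvalue `a`. Its eigenvectors form a space over the centralizer of `a` on which the
remaining operators are still irreducible, and the centralizer inherits 3, so induction applies. -/

theorem Polynomial.exists_eq_mul_X_sub_C_add {R : Type*} [Ring R] (p : R[X]) (a : R) :
    ∃ q : R[X], p = q * (X - C a) + C (p.eval a) := by
  induction p using Polynomial.induction_on with
  | C c => exact ⟨0, by simp⟩
  | add p q hp hq =>
    obtain ⟨p', hp⟩ := hp
    obtain ⟨q', hq⟩ := hq
    refine ⟨p' + q', ?_⟩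
    conv_lhs => rw [hp, hq]
    rw [eval_add, C_add, add_mul]
    abel
  | monomial n c h =>
    obtain ⟨q, hq⟩ := h
    refine ⟨q * X + C ((C c * X ^ n).eval a), ?_⟩
    rw [pow_succ, ← mul_assoc, eval_mul_X, C_mul]
    conv_lhs => rw [hq]
    rw [add_mul, add_mul, mul_assoc, mul_assoc, mul_sub, mul_sub, mul_sub, X_mul_C a,
      X_mul]
    simp only [mul_sub, sub_mul]
    abel

/-- The quotient of `D[X]` by a nonzero left ideal is finite-dimensional over `D`. -/
theorem Polynomial.finite_quotient_of_ne_bot {L : Ideal D[X]} (hL : L ≠ ⊥) :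
    Module.Finite D (D[X] ⧸ L) := by
  obtain ⟨f, hfL, hf⟩ := Submodule.exists_mem_ne_zero_of_ne_bot hL
  have key : ∀ (n : ℕ) (p : D[X]), p.degree < n →
      ∃ r ∈ degreeLT D f.natDegree, p - r ∈ L := by
    intro n
    induction n with
    | zero => exact fun p hp => ⟨0, zero_mem _, by
        have : p = 0 := by simpa using hp
        simp [this]⟩
    | succ n ih =>
      intro p hp
      by_cases h : n < f.natDegree
      · refine ⟨p, mem_degreeLT.2 (hp.trans_le ?_), by simp⟩
        exact_mod_cast h
      · push Not at h
        -- Left division: `s * f` has the same coefficient at `X ^ n` as `p`.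
        set s : D[X] := C (p.coeff n * f.leadingCoeff⁻¹) * X ^ (n - f.natDegree) with hs
        have hlt : (p - s * f).degree < n := by
          rw [degree_lt_iff_coeff_zero]
          intro m hm
          rw [coeff_sub, hs, mul_assoc, coeff_C_mul, coeff_X_pow_mul']
          rcases hm.eq_or_lt with rfl | hm
          · rw [if_pos (Nat.sub_le _ _), Nat.sub_sub_self h, coeff_natDegree, mul_assoc,
              inv_mul_cancel₀ (leadingCoeff_ne_zero.2 hf), mul_one, sub_self]
          · rw [(degree_lt_iff_coeff_zero p (n + 1)).1 hp m hm, if_pos (by omega),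
              coeff_eq_zero_of_natDegree_lt (p := f) (by omega), mul_zero, sub_zero]
        obtain ⟨r, hr, h'⟩ := ih _ hlt
        refine ⟨r, hr, ?_⟩
        have := L.add_mem h' (L.mul_mem_left s hfL)
        convert this using 1
        abel
  let φ : degreeLT D f.natDegree →ₗ[D] D[X] ⧸ L :=
    (L.mkQ.restrictScalars D).comp (degreeLT D f.natDegree).subtype
  have : Module.Finite D (degreeLT D f.natDegree) :=
    Module.Finite.equiv (degreeLTEquiv D f.natDegree).symm
  refine Module.Finite.of_surjective φ fun y => ?_
  obtain ⟨p, rfl⟩ := L.mkQ_surjective y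
  obtain ⟨r, hr, h⟩ := key (p.natDegree + 1) p
    (degree_le_natDegree.trans_lt (by exact_mod_cast Nat.lt_succ_self _))
  exact ⟨⟨r, hr⟩, ((Submodule.Quotient.eq L).2 h).symm⟩

/-- Left multiplication by a central polynomial on a quotient by a left ideal. -/
noncomputable def Polynomial.centralMul (L : Ideal D[X]) (q : Subring.center D[X]) :
    D[X] ⧸ L →ₗ[D] D[X] ⧸ L where
  toFun m := (q : D[X]) • m
  map_add' := smul_add _
  map_smul' d m := by
    have h : ∀ m : D[X] ⧸ L, d • m = C d • m := fun m => by
      obtain ⟨v, rfl⟩ := L.mkQ_surjective m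
      change L.mkQ (d • v) = C d • L.mkQ v
      rw [smul_eq_C_mul, ← smul_eq_mul, map_smul]
    rw [RingHom.id_apply, h, h, smul_smul, smul_smul, Subring.mem_center_iff.1 q.2]

/-- The quotient is Noetherian over `D`, so some kernel of multiplication by a nonzero central `p`
is maximal. As `ker p ≤ ker (q * p)`, these agree for every `q ≠ 0`, and `ker q ≤ ker (q * p) = ker
p`. -/
theorem Polynomial.exists_central_saturation {L : Ideal D[X]} (hL : L ≠ ⊥) :
    ∃ p : Subring.center D[X], p ≠ 0 ∧ ∀ q : Subring.center D[X], q ≠ 0 →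
      ∀ v, (q : D[X]) * v ∈ L → (p : D[X]) * v ∈ L := by
  have := finite_quotient_of_ne_bot hL
  let S : Set (Submodule D (D[X] ⧸ L)) :=
    {K | ∃ q : Subring.center D[X], q ≠ 0 ∧ K = LinearMap.ker (centralMul L q)}
  obtain ⟨K, ⟨p, hp, rfl⟩, hmax⟩ := set_has_maximal_iff_noetherian.2
    (inferInstance : IsNoetherian D (D[X] ⧸ L)) S ⟨_, 1, one_ne_zero, rfl⟩
  have hmem : ∀ (q : Subring.center D[X]) (v : D[X]),
      L.mkQ v ∈ LinearMap.ker (centralMul L q) ↔ (q : D[X]) * v ∈ L := by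
    intro q v
    change (q : D[X]) • L.mkQ v = 0 ↔ _
    rw [← map_smul, Submodule.mkQ_apply, Submodule.Quotient.mk_eq_zero, smul_eq_mul]
  refine ⟨p, hp, fun q hq v hv => ?_⟩
  have hle : LinearMap.ker (centralMul L p) ≤ LinearMap.ker (centralMul L (q * p)) := by
    intro m
    obtain ⟨w, rfl⟩ := L.mkQ_surjective m
    rw [hmem, hmem]
    intro h
    rw [Subring.coe_mul, mul_assoc]
    exact L.mul_mem_left _ h
  have heq := hle.eq_of_not_lt (hmax _ ⟨q * p, mul_ne_zero hq hp, rfl⟩)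
  rw [← hmem, heq, hmem, mul_comm, Subring.coe_mul, mul_assoc]
  exact L.mul_mem_left _ hv

theorem Polynomial.X_mem_center : (X : D[X]) ∈ Subring.center D[X] :=
  Subring.mem_center_iff.2 fun p => (X_mul (p := p)).symm

/-- For finitely many nonzero left ideals of `D[X]` there is a nonconstant central polynomial
which is a nonzerodivisor on the quotient by every left ideal containing one of them. -/
theorem Polynomial.exists_central_coprime {ι : Type*} (s : Finset ι) (L : ι → Ideal D[X])
    (hL : ∀ i ∈ s, L i ≠ ⊥) :
    ∃ g ∈ Subring.center D[X], 0 < g.natDegree ∧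
      ∀ i ∈ s, ∀ L', L i ≤ L' → ∀ v, g * v ∈ L' → v ∈ L' := by
  classical
  have : ∀ i, ∃ p : Subring.center D[X], p ≠ 0 ∧ (i ∈ s → ∀ q : Subring.center D[X], q ≠ 0 →
      ∀ v, (q : D[X]) * v ∈ L i → (p : D[X]) * v ∈ L i) := by
    intro i
    by_cases hi : i ∈ s
    · obtain ⟨p, hp, h⟩ := exists_central_saturation (hL i hi)
      exact ⟨p, hp, fun _ => h⟩
    · exact ⟨1, one_ne_zero, fun h => absurd h hi⟩
  choose p hp0 hp using this
  let P : Subring.center D[X] := ∏ i ∈ s, p i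
  have hP : P ≠ 0 := Finset.prod_ne_zero_iff.2 fun i _ => hp0 i
  -- Euclid's trick: `g` is nonconstant and congruent to 1 modulo `P`. If `g` kills a class,
  -- saturation makes `P` kill it, and then so does 1.
  let g : Subring.center D[X] := 1 + P * ⟨X, X_mem_center⟩
  have hgdeg : 0 < (g : D[X]).natDegree := by
    have hP' : (P : D[X]) ≠ 0 := fun h => hP (Subtype.ext h)
    have : (g : D[X]).natDegree = (P : D[X]).natDegree + 1 := by
      change (1 + (P : D[X]) * X).natDegree = _
      rw [natDegree_add_eq_right_of_natDegree_lt, natDegree_mul_X hP']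
      rw [natDegree_mul_X hP', natDegree_one]
      omega
    omega
  have hg0 : g ≠ 0 := by
    intro h
    rw [h] at hgdeg
    simp at hgdeg
  refine ⟨g, g.2, hgdeg, fun i hi L' hLL' => ?_⟩
  have := finite_quotient_of_ne_bot (hL i hi)
  have hinj : Function.Injective (centralMul (L i) g) := by
    rw [← LinearMap.ker_eq_bot, LinearMap.ker_eq_bot']
    intro m hm
    obtain ⟨v, rfl⟩ := (L i).mkQ_surjective m
    change (g : D[X]) • (L i).mkQ v = 0 at hm
    rw [← map_smul, Submodule.mkQ_apply, Submodule.Quotient.mk_eq_zero, smul_eq_mul] at hm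
    rw [Submodule.mkQ_apply, Submodule.Quotient.mk_eq_zero]
    have hPv : (P : D[X]) * v ∈ L i := by
      have h1 := hp i hi g hg0 v hm
      have h2 : P = (∏ j ∈ s.erase i, p j) * p i := (Finset.prod_erase_mul s p hi).symm
      rw [h2, Subring.coe_mul, mul_assoc]
      exact (L i).mul_mem_left _ h1
    have h3 : v = (g : D[X]) * v - X * ((P : D[X]) * v) := by
      change v = (1 + (P : D[X]) * X) * v - X * ((P : D[X]) * v)
      rw [add_mul, one_mul, ← X_mul, mul_assoc]
      abel
    rw [h3]
    exact (L i).sub_mem hm ((L i).mul_mem_left _ hPv)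
  -- In finite dimension injectivity equals surjectivity; surjectivity passes to the further
  -- quotient by `L'`, where it gives injectivity back.
  have hsurj : ∀ v, ∃ u, v - (g : D[X]) * u ∈ L i := by
    intro v
    obtain ⟨m, hm⟩ := LinearMap.injective_iff_surjective.1 hinj ((L i).mkQ v)
    obtain ⟨u, rfl⟩ := (L i).mkQ_surjective m
    exact ⟨u, (Submodule.Quotient.eq (L i)).1 hm.symm⟩
  have hL' : L' ≠ ⊥ := fun h => hL i hi (le_bot_iff.1 (h ▸ hLL'))
  have := finite_quotient_of_ne_bot hL'
  have hsurj' : Function.Surjective (centralMul L' g) := by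
    intro m
    obtain ⟨v, rfl⟩ := L'.mkQ_surjective m
    obtain ⟨u, hu⟩ := hsurj v
    exact ⟨L'.mkQ u, ((Submodule.Quotient.eq L').2 (hLL' hu)).symm⟩
  have hinj' := LinearMap.injective_iff_surjective.2 hsurj'
  intro v hv
  rw [← Submodule.Quotient.mk_eq_zero L']
  apply hinj'
  rw [map_zero]
  exact (Submodule.Quotient.mk_eq_zero L').2 hv

end OneVariable

/-! ### Monomials in commuting elements. -/

/-- The monomials in a tuple of pairwise commuting elements. -/
noncomputable def commPow {E : Type*} [Monoid E] {n : ℕ} (b : Fin n → E)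
    (hb : ∀ i j, Commute (b i) (b j)) : Multiplicative (Fin n → ℕ) →* E :=
  (MonoidHom.noncommPiCoprod (N := fun _ : Fin n => Multiplicative ℕ) (fun i => powersHom E (b i))
    fun i j _ x y => by
      simpa [powersHom_apply] using (hb i j).pow_pow x.toAdd y.toAdd).comp
    { toFun := fun γ i => Multiplicative.ofAdd (γ.toAdd i)
      map_one' := rfl
      map_mul' := fun _ _ => rfl }

theorem commPow_single {E : Type*} [Monoid E] {n : ℕ} (b : Fin n → E)
    (hb : ∀ i j, Commute (b i) (b j)) (i : Fin n) :
    commPow b hb (Multiplicative.ofAdd (Pi.single i 1)) = b i := by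
  have h : (fun j => Multiplicative.ofAdd ((Pi.single i 1 : Fin n → ℕ) j)) =
      Pi.mulSingle (M := fun _ => Multiplicative ℕ) i (Multiplicative.ofAdd 1) := by
    funext j
    rcases eq_or_ne j i with rfl | hj
    · simp
    · simp [hj]
  rw [commPow, MonoidHom.comp_apply]
  change MonoidHom.noncommPiCoprod (N := fun _ : Fin n => Multiplicative ℕ) _ _
    (fun j => Multiplicative.ofAdd ((Pi.single i 1 : Fin n → ℕ) j)) = _
  rw [h]
  refine (MonoidHom.noncommPiCoprod_mulSingle (N := fun _ : Fin n => Multiplicative ℕ)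
    _ i _).trans ?_
  simp [powersHom_apply]

/-! ### Generic freeness and torsion in irreducible modules. -/

section Torsion

variable {D : Type*} [DivisionRing D]

/-- A form of generic freeness: a cyclic module over polynomials in further commuting variables
whose generator is torsion-free over `D[X]` is not divisible by all central polynomials. -/
theorem Polynomial.exists_central_forall_smul_ne {M : Type*} [AddCommGroup M] [Module D[X] M]
    {n : ℕ} (Y : Multiplicative (Fin n → ℕ) →* Module.End D[X] M) (v : M)
    (hspan : Submodule.span D[X] (Set.range fun γ => Y γ v) = ⊤)
    (hv : ∀ c : D[X], c • v = 0 → c = 0) :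
    ∃ g ∈ Subring.center D[X], g ≠ 0 ∧ ∀ m : M, g • m ≠ v := by
  let y : Lex (Fin n → ℕ) → M := fun γ => Y (Multiplicative.ofAdd (ofLex γ)) v
  have hy0 : y 0 = v := by
    change Y 1 v = v
    rw [map_one, Module.End.one_apply]
  have hyadd : ∀ α γ, y (α + γ) = Y (Multiplicative.ofAdd (ofLex γ)) (y α) := by
    intro α γ
    rw [add_comm]
    change Y (Multiplicative.ofAdd (ofLex γ) * Multiplicative.ofAdd (ofLex α)) v = _
    rw [map_mul, Module.End.mul_apply]
  -- Filter `M` by the lexicographic order of the monomials. `L γ` is the left ideal of leading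
  -- coefficients at `γ`, so that the graded pieces are the quotients `D[X] ⧸ L γ`.
  let N : Lex (Fin n → ℕ) → Submodule D[X] M := fun γ => Submodule.span D[X] (y '' Set.Iio γ)
  let L : Lex (Fin n → ℕ) → Ideal D[X] := fun γ =>
    (N γ).comap (LinearMap.toSpanSingleton D[X] M (y γ))
  have hLmem : ∀ γ c, c ∈ L γ ↔ c • y γ ∈ N γ := fun γ c => Iff.rfl
  have hLadd : ∀ α γ, L α ≤ L (α + γ) := by
    intro α γ c hc
    rw [hLmem] at hc ⊢
    rw [hyadd, ← map_smul]
    have hle : (N α).map (Y (Multiplicative.ofAdd (ofLex γ))) ≤ N (α + γ) := by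
      rw [Submodule.map_span, Submodule.span_le]
      rintro _ ⟨_, ⟨β, hβ, rfl⟩, rfl⟩
      rw [← hyadd]
      exact Submodule.subset_span ⟨β + γ, add_lt_add_left hβ γ, rfl⟩
    exact hle ⟨_, hc, rfl⟩
  -- By Dickson's lemma `S` has finitely many minimal exponents. Since `L` grows along addition, a
  -- `g` coprime to the `L` at these exponents is a nonzerodivisor on every graded piece.
  let S : Set (Fin n → ℕ) := {γ | L (toLex γ) ≠ ⊥}
  have hfin : {γ | Minimal (· ∈ S) γ}.Finite :=
    WellQuasiOrderedLE.finite_of_isAntichain (setOfPred_minimal_antichain _)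
  obtain ⟨g, hgc, hgdeg, hg⟩ := exists_central_coprime hfin.toFinset (fun γ => L (toLex γ))
    fun γ hγ => (hfin.mem_toFinset.1 hγ).prop
  have hg0 : g ≠ 0 := by
    rintro rfl
    simp at hgdeg
  have hsat : ∀ γ c, g * c ∈ L γ → c ∈ L γ := by
    intro γ c hc
    by_cases hγ : L γ = ⊥
    · rw [hγ, Submodule.mem_bot] at hc ⊢
      exact (mul_eq_zero.1 hc).resolve_left hg0
    · obtain ⟨β, hβγ, hβ⟩ := exists_minimal_le_of_wellFoundedLT (· ∈ S) (ofLex γ) hγ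
      refine hg β (hfin.mem_toFinset.2 hβ) (L γ) ?_ c hc
      have := hLadd (toLex β) (toLex (ofLex γ - β))
      rwa [← toLex_add, add_tsub_cancel_of_le hβγ] at this
  -- Descent on the leading exponent: for `γ > ⊥`, `v` lies in `N γ`, so the leading coefficient of
  -- `m` is in `L γ` and `m` drops lower. At the bottom `m = c • v`, so torsion-freeness of `v`
  -- would make the nonconstant `g` a unit.
  have key : ∀ γ, ∀ m ∈ Submodule.span D[X] (y '' Set.Iic γ), g • m ≠ v := by
    intro γ
    induction γ using WellFoundedLT.induction with
    | ind γ ih =>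
      intro m hm hgm
      rw [← Set.Iio_insert, Set.image_insert_eq, Submodule.mem_span_insert] at hm
      obtain ⟨c, m', hm', rfl⟩ := hm
      rcases (bot_le : ⊥ ≤ γ).eq_or_lt with rfl | hpos
      · rw [Set.Iio_bot, Set.image_empty, Submodule.span_empty, Submodule.mem_bot] at hm'
        have hyb : y ⊥ = v := hy0
        rw [hm', add_zero, hyb] at hgm
        have h1 : (g * c - 1) • v = 0 := by rw [sub_smul, mul_smul, hgm, one_smul, sub_self]
        have h2 := sub_eq_zero.1 (hv _ h1)
        have h3 : IsUnit g := by
          have : c * g = 1 := by rw [Subring.mem_center_iff.1 hgc, h2]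
          exact ⟨⟨g, c, h2, this⟩, rfl⟩
        exact hgdeg.ne' (natDegree_eq_zero_of_isUnit h3)
      · have hvN : v ∈ N γ := Submodule.subset_span ⟨⊥, hpos, hy0⟩
        have hc : c ∈ L γ := by
          apply hsat
          rw [hLmem, mul_smul]
          have : g • c • y γ = v - g • m' := by rw [← hgm, smul_add, add_sub_cancel_right]
          rw [this]
          exact (N γ).sub_mem hvN ((N γ).smul_mem _ hm')
        have hmN : c • y γ + m' ∈ N γ := (N γ).add_mem hc hm'
        have hex : ∃ β < γ, c • y γ + m' ∈ Submodule.span D[X] (y '' Set.Iic β) := by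
          refine Submodule.span_induction
            (p := fun m _ => ∃ β < γ, m ∈ Submodule.span D[X] (y '' Set.Iic β)) ?_ ?_ ?_ ?_ hmN
          · rintro _ ⟨β, hβ, rfl⟩
            exact ⟨β, hβ, Submodule.subset_span ⟨β, Set.mem_Iic.2 le_rfl, rfl⟩⟩
          · exact ⟨⊥, hpos, zero_mem _⟩
          · rintro a b _ _ ⟨α, hα, ha⟩ ⟨β, hβ, hb⟩
            refine ⟨max α β, max_lt hα hβ, add_mem ?_ ?_⟩
            · exact Submodule.span_mono (Set.image_mono (Set.Iic_subset_Iic.2 (le_max_left _ _))) ha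
            · exact Submodule.span_mono (Set.image_mono (Set.Iic_subset_Iic.2 (le_max_right _ _))) hb
          · rintro r a _ ⟨α, hα, ha⟩
            exact ⟨α, hα, Submodule.smul_mem _ _ ha⟩
        obtain ⟨β, hβ, hm⟩ := hex
        exact ih β hβ _ hm hgm
  refine ⟨g, hgc, hg0, fun m => ?_⟩
  have hm : m ∈ Submodule.span D[X] (Set.range fun γ => Y γ v) := hspan ▸ Submodule.mem_top
  have hex : ∃ β, m ∈ Submodule.span D[X] (y '' Set.Iic β) := by
    refine Submodule.span_induction
      (p := fun m _ => ∃ β, m ∈ Submodule.span D[X] (y '' Set.Iic β)) ?_ ?_ ?_ ?_ hm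
    · rintro _ ⟨β, rfl⟩
      exact ⟨toLex β.toAdd, Submodule.subset_span ⟨_, Set.mem_Iic.2 le_rfl, rfl⟩⟩
    · exact ⟨⊥, zero_mem _⟩
    · rintro a b _ _ ⟨α, ha⟩ ⟨β, hb⟩
      refine ⟨max α β, add_mem ?_ ?_⟩
      · exact Submodule.span_mono (Set.image_mono (Set.Iic_subset_Iic.2 (le_max_left _ _))) ha
      · exact Submodule.span_mono (Set.image_mono (Set.Iic_subset_Iic.2 (le_max_right _ _))) hb
    · rintro r a _ ⟨α, ha⟩
      exact ⟨α, Submodule.smul_mem _ _ ha⟩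
  obtain ⟨β, hβ⟩ := hex
  exact key β m hβ

variable {M : Type*} [AddCommGroup M] [Module D M]

/-- A polynomial over `D` evaluated at a `D`-linear endomorphism. -/
noncomputable def evalEnd (T : Module.End D M) : D[X] →+* AddMonoid.End M :=
  eval₂RingHom' (Module.toAddMonoidEnd D M) T.toAddMonoidHom fun a => by
    ext m
    exact (T.map_smul a m).symm

theorem evalEnd_C (T : Module.End D M) (d : D) (m : M) : evalEnd T (C d) m = d • m := by
  exact DFunLike.congr_fun (eval₂_C (Module.toAddMonoidEnd D M) T.toAddMonoidHom) m

theorem evalEnd_X (T : Module.End D M) (m : M) : evalEnd T X m = T m := by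
  exact DFunLike.congr_fun (eval₂_X (Module.toAddMonoidEnd D M) T.toAddMonoidHom) m

/-- No nontrivial subspace is invariant under the family `T` of endomorphisms. -/
def IsIrreducibleFamily {ι : Type*} (T : ι → Module.End D M) : Prop :=
  ∀ N : Submodule D M, (∀ i, ∀ m ∈ N, T i m ∈ N) → N = ⊥ ∨ N = ⊤

/-- If `v` were torsion-free over `D[X]`, with `X` acting as `T 0`, irreducibility would make `M`
generated by the monomials in the other operators applied to `v`. For the central `g` of generic
freeness, `gM` is invariant and nonzero, hence all of `M`, yet it omits `v`. -/
theorem exists_evalEnd_eq_zero {n : ℕ} (T : Fin (n + 1) → Module.End D M)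
    (hT : ∀ i j, Commute (T i) (T j)) (hM : IsIrreducibleFamily T) {v : M} (hv : v ≠ 0) :
    ∃ p : D[X], p ≠ 0 ∧ evalEnd (T 0) p v = 0 := by
  by_contra! hcon
  let _ : Module D[X] M := Module.compHom M (evalEnd (T 0))
  have hC : ∀ (d : D) (m : M), C d • m = d • m := evalEnd_C (T 0)
  have hX : ∀ m : M, (X : D[X]) • m = T 0 m := evalEnd_X (T 0)
  have hTsmul : ∀ i (p : D[X]) (m : M), T i (p • m) = p • T i m := by
    intro i p
    induction p using Polynomial.induction_on' with
    | add p q hp hq => intro m; rw [add_smul, map_add, hp, hq, add_smul]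
    | monomial k a =>
      intro m
      rw [← C_mul_X_pow_eq_monomial, mul_smul, mul_smul, hC, hC, map_smul]
      congr 1
      induction k generalizing m with
      | zero => simp
      | succ k ih =>
        rw [pow_succ, mul_smul, mul_smul, ih, hX, hX]
        congr 1
        exact LinearMap.congr_fun (hT i 0) m
  let T' : Fin n → Module.End D[X] M := fun i =>
    { toFun := T i.succ, map_add' := map_add _, map_smul' := hTsmul i.succ }
  have hT' : ∀ i j, Commute (T' i) (T' j) := fun i j =>
    LinearMap.ext fun m => LinearMap.congr_fun (hT i.succ j.succ) m
  have hsub : ∀ N : Submodule D[X] M, (∀ i, ∀ m ∈ N, T' i m ∈ N) → N = ⊥ ∨ N = ⊤ := by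
    intro N hN
    let N' : Submodule D M :=
      { N.toAddSubmonoid with smul_mem' := fun d m hm => hC d m ▸ N.smul_mem (C d) hm }
    have := hM N' fun i => by
      refine Fin.cases ?_ (fun i => ?_) i
      · intro m hm
        rw [← hX]
        exact N.smul_mem X hm
      · exact hN i
    refine this.imp (fun h => ?_) (fun h => ?_)
    · ext m
      exact (SetLike.ext_iff.1 h m)
    · ext m
      exact (SetLike.ext_iff.1 h m)
  let Y := commPow T' hT'
  have hspan : Submodule.span D[X] (Set.range fun γ => Y γ v) = ⊤ := by
    refine (hsub _ fun i m hm => ?_).resolve_left fun h => ?_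
    · have hle : (Submodule.span D[X] (Set.range fun γ => Y γ v)).map (T' i) ≤
          Submodule.span D[X] (Set.range fun γ => Y γ v) := by
        rw [Submodule.map_span, Submodule.span_le]
        rintro _ ⟨_, ⟨γ, rfl⟩, rfl⟩
        refine Submodule.subset_span ⟨Multiplicative.ofAdd (Pi.single i 1) * γ, ?_⟩
        simp only [Y, map_mul, commPow_single]
        rfl
      exact hle ⟨m, hm, rfl⟩
    · have hmem : v ∈ Submodule.span D[X] (Set.range fun γ => Y γ v) :=
        Submodule.subset_span ⟨1, by simp⟩
      rw [h, Submodule.mem_bot] at hmem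
      exact hv hmem
  obtain ⟨g, hgc, hg0, hg⟩ := exists_central_forall_smul_ne Y v hspan fun c hc => by
    by_contra hc0
    exact hcon c hc0 hc
  let N : Submodule D[X] M :=
    { carrier := Set.range fun m : M => g • m
      add_mem' := by
        rintro _ _ ⟨a, rfl⟩ ⟨b, rfl⟩
        exact ⟨a + b, smul_add _ _ _⟩
      zero_mem' := ⟨0, smul_zero _⟩
      smul_mem' := by
        rintro p _ ⟨a, rfl⟩
        refine ⟨p • a, ?_⟩
        change g • p • a = p • g • a
        rw [smul_smul, smul_smul, Subring.mem_center_iff.1 hgc] }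
  have hN : N = ⊤ := by
    refine (hsub N ?_).resolve_left fun h => ?_
    · rintro i _ ⟨a, rfl⟩
      exact ⟨T' i a, ((T' i).map_smul g a).symm⟩
    · have hmem : g • v ∈ N := ⟨v, rfl⟩
      rw [h, Submodule.mem_bot] at hmem
      exact hcon g hg0 hmem
  have hvN : v ∈ N := hN ▸ Submodule.mem_top
  obtain ⟨m, hm⟩ := hvN
  exact hg m hm

end Torsion

/-! ### Eigenvectors and centralizers. -/

section Eigenvectors

variable {D : Type*} [DivisionRing D]

theorem IsRightAC.of_ringEquiv {K L : Type*} [DivisionRing K] [DivisionRing L] (e : K ≃+* L)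
    (hK : IsRightAC K) : IsRightAC L := by
  intro p hp
  obtain ⟨a, ha⟩ := hK (p.map (e.symm : L →+* K)) (by
    rwa [natDegree_map_eq_of_injective e.symm.injective])
  refine ⟨e a, ?_⟩
  rw [IsRoot.def, eval_map] at ha
  have h := congrArg (e : K →+* L) ha
  rw [hom_eval₂, map_zero, RingEquiv.comp_symm] at h
  exact h

theorem mem_divisionCentralizer_range {ι : Type*} {a : ι → D} {c : D} :
    c ∈ divisionCentralizer (Set.range a) ↔ ∀ i, a i * c = c * a i := by
  change c ∈ Set.centralizer (Set.range a) ↔ _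
  rw [Set.mem_centralizer_iff]
  exact Set.forall_mem_range

/-- The centralizer of a point in a centrally algebraically closed ring is again centrally
algebraically closed. -/
theorem isCentrallyAC_divisionCentralizer (hD : IsCentrallyAC D) (a : D) :
    IsCentrallyAC (divisionCentralizer (Set.range fun _ : Fin 1 => a)) := by
  intro n b hb
  have hmem : ∀ {c : D}, c ∈ divisionCentralizer (Set.range fun _ : Fin 1 => a) ↔
      a * c = c * a := by
    intro c
    rw [mem_divisionCentralizer_range, forall_const]
  have hmem' : ∀ {c : D}, c ∈ divisionCentralizer
      (Set.range (Fin.cons a fun i => (b i : D) : Fin (n + 1) → D)) ↔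
      a * c = c * a ∧ ∀ i, (b i : D) * c = c * b i := by
    intro c
    rw [mem_divisionCentralizer_range, Fin.forall_fin_succ]
    simp only [Fin.cons_zero, Fin.cons_succ]
  let e : divisionCentralizer (Set.range (Fin.cons a fun i => (b i : D) : Fin (n + 1) → D)) ≃+*
      divisionCentralizer (Set.range b) :=
    { toFun := fun c => ⟨⟨c, hmem.2 (hmem'.1 c.2).1⟩, mem_divisionCentralizer_range.2 fun i =>
        Subtype.ext ((hmem'.1 c.2).2 i)⟩
      invFun := fun c => ⟨c.1.1, hmem'.2 ⟨hmem.1 c.1.2, fun i =>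
        congrArg Subtype.val (mem_divisionCentralizer_range.1 c.2 i)⟩⟩
      left_inv := fun _ => rfl
      right_inv := fun _ => rfl
      map_mul' := fun _ _ => rfl
      map_add' := fun _ _ => rfl }
  refine IsRightAC.of_ringEquiv e (hD (n + 1) (Fin.cons a fun i => (b i : D)) ?_)
  have h : ∀ i, Commute a (b i : D) := fun i => hmem.1 (b i).2
  refine Fin.cases (Fin.cases ?_ fun j => ?_) fun i => Fin.cases ?_ fun j => ?_
  · exact Commute.refl _
  · simpa using h j
  · simpa using (h i).symm
  · have hij : (b i : D) * b j = b j * b i := congrArg Subtype.val (hb i j)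
    exact hij

variable {M : Type*} [AddCommGroup M] [Module D M]

/-- A right root splits off a right factor, `p = q * (X - C a)`, which acts on `v` first. Either `v`
is an eigenvector, or `T v - a • v` is a nonzero vector killed by `q`, of smaller degree. -/
theorem exists_eigenvector_of_evalEnd_eq_zero (hD : IsRightAC D) (T : Module.End D M) (p : D[X])
    (hp : p ≠ 0) {v : M} (hv : v ≠ 0) (h : evalEnd T p v = 0) :
    ∃ (a : D) (u : M), u ≠ 0 ∧ T u = a • u := by
  induction hn : p.natDegree using Nat.strong_induction_on generalizing p v with
  | _ n ih =>
    rcases Nat.eq_zero_or_pos n with rfl | hpos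
    · obtain ⟨d, rfl⟩ := natDegree_eq_zero.1 hn
      rw [evalEnd_C] at h
      exact absurd ((smul_eq_zero.1 h).resolve_right hv) (by simpa using hp)
    · obtain ⟨a, ha⟩ := hD p (hn ▸ hpos)
      obtain ⟨q, hq⟩ := p.exists_eq_mul_X_sub_C_add a
      rw [ha.eq_zero, C_0, add_zero] at hq
      have hq0 : q ≠ 0 := by
        rintro rfl
        exact hp (by rw [hq, zero_mul])
      have hXC : evalEnd T (X - C a) v = T v - a • v := by
        rw [map_sub, ← evalEnd_X, ← evalEnd_C T a]
        rfl
      by_cases hu : T v - a • v = 0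
      · exact ⟨a, v, hv, sub_eq_zero.1 hu⟩
      · rw [hq, map_mul] at h
        change evalEnd T q (evalEnd T (X - C a) v) = 0 at h
        rw [hXC] at h
        refine ih q.natDegree ?_ q hq0 hu h rfl
        rw [← hn, hq, natDegree_mul hq0 (X_sub_C_ne_zero a), natDegree_X_sub_C]
        exact Nat.lt_succ_self _

theorem exists_eigenvector (hD : IsRightAC D) {n : ℕ} [Nontrivial M]
    (T : Fin (n + 1) → Module.End D M) (hT : ∀ i j, Commute (T i) (T j))
    (hM : IsIrreducibleFamily T) : ∃ (a : D) (u : M), u ≠ 0 ∧ T 0 u = a • u := by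
  obtain ⟨v, hv⟩ := exists_ne (0 : M)
  obtain ⟨p, hp, h⟩ := exists_evalEnd_eq_zero T hT hM hv
  exact exists_eigenvector_of_evalEnd_eq_zero hD (T 0) p hp hv h

/-- The eigenvectors of `T` for `a`, as a space over the centralizer of `a`. -/
def eigenvectors (T : Module.End D M) (a : D) :
    Submodule (divisionCentralizer (Set.range fun _ : Fin 1 => a)) M where
  carrier := {m | T m = a • m}
  add_mem' {x y} hx hy := by
    change T (x + y) = a • (x + y)
    rw [map_add, smul_add, show T x = a • x from hx, show T y = a • y from hy]
  zero_mem' := by simp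
  smul_mem' c x hx := by
    change T ((c : D) • x) = a • (c : D) • x
    rw [map_smul, show T x = a • x from hx, smul_smul, smul_smul,
      mem_divisionCentralizer_range.1 c.2 0]

theorem mem_eigenvectors {T : Module.End D M} {a : D} {m : M} :
    m ∈ eigenvectors T a ↔ T m = a • m := Iff.rfl

/-- Eigenvectors in the `D`-span of a `C(a)`-subspace of eigenvectors lie in that subspace. -/
theorem mem_of_mem_span_of_mem_eigenvectors (T : Module.End D M) (a : D)
    {W : Submodule (divisionCentralizer (Set.range fun _ : Fin 1 => a)) M}
    (hW : W ≤ eigenvectors T a) (s : Finset M) (hs : ∀ w ∈ s, w ∈ W) {u : M}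
    (hu : u ∈ eigenvectors T a) (f : M → D) (hf : u = ∑ w ∈ s, f w • w) : u ∈ W := by
  classical
  induction hn : s.card generalizing s f with
  | zero =>
    rw [hf, Finset.card_eq_zero.1 hn, Finset.sum_empty]
    exact zero_mem W
  | succ n ih =>
    -- Comparing `T u` with `a • u` gives a relation whose coefficients are commutators with `a`. If
    -- all vanish, the `f w` lie in the centralizer; otherwise a nonzero one is used to eliminate
    -- its vector, shortening the expression of `u`.
    have h0 : ∑ w ∈ s, (f w * a - a * f w) • w = 0 := by
      have h1 : T u = ∑ w ∈ s, (f w * a) • w := by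
        rw [hf, map_sum]
        refine Finset.sum_congr rfl fun w hw => ?_
        rw [map_smul, mem_eigenvectors.1 (hW (hs w hw)), smul_smul]
      have h2 : a • u = ∑ w ∈ s, (a * f w) • w := by
        rw [hf, Finset.smul_sum]
        exact Finset.sum_congr rfl fun w _ => smul_smul _ _ _
      simp only [sub_smul]
      rw [Finset.sum_sub_distrib, ← h1, ← h2, mem_eigenvectors.1 hu, sub_self]
    by_cases hall : ∀ w ∈ s, a * f w = f w * a
    · rw [hf]
      refine sum_mem fun w hw => ?_
      exact W.smul_mem ⟨f w, mem_divisionCentralizer_range.2 fun _ => hall w hw⟩ (hs w hw)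
    · push Not at hall
      obtain ⟨w₀, hw₀, hne⟩ := hall
      have he : f w₀ * a - a * f w₀ ≠ 0 := sub_ne_zero.2 hne.symm
      set e := f w₀ * a - a * f w₀ with hedef
      refine ih (s.erase w₀) (fun w hw => hs w (Finset.mem_of_mem_erase hw))
        (fun w => f w - f w₀ * e⁻¹ * (f w * a - a * f w)) ?_ ?_
      · have h3 : u = ∑ w ∈ s, (f w - f w₀ * e⁻¹ * (f w * a - a * f w)) • w := by
          have h4 := congrArg (fun m => (f w₀ * e⁻¹) • m) h0
          simp only [smul_zero, Finset.smul_sum, smul_smul] at h4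
          simp only [sub_smul]
          rw [Finset.sum_sub_distrib, ← hf]
          rw [h4, sub_zero]
        rw [← Finset.add_sum_erase s _ hw₀, ← hedef, mul_assoc, inv_mul_cancel₀ he, mul_one,
          sub_self, zero_smul, zero_add] at h3
        exact h3
      · rw [Finset.card_erase_of_mem hw₀, hn, Nat.add_sub_cancel]

end Eigenvectors

/-- Over a centrally algebraically closed division ring, an irreducible commuting family of
endomorphisms acts on a line. -/
theorem IsCentrallyAC.exists_forall_eq_smul (n : ℕ) {D : Type*} [DivisionRing D]
    (hD : IsCentrallyAC D) {M : Type*} [AddCommGroup M] [Module D M] [Nontrivial M]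
    (T : Fin n → Module.End D M) (hT : ∀ i j, Commute (T i) (T j)) (hM : IsIrreducibleFamily T) :
    ∃ v : M, ∀ m : M, ∃ d : D, m = d • v := by
  induction n generalizing D M with
  | zero =>
    obtain ⟨v, hv⟩ := exists_ne (0 : M)
    refine ⟨v, fun m => ?_⟩
    have h := (hM (D ∙ v) fun i => i.elim0).resolve_left (by simpa using hv)
    obtain ⟨d, hd⟩ := Submodule.mem_span_singleton.1 (h ▸ Submodule.mem_top : m ∈ D ∙ v)
    exact ⟨d, hd.symm⟩
  | succ n ih =>
    -- The centralizer of the empty tuple is `D` itself.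
    have hD' : IsRightAC D := by
      refine (hD 0 Fin.elim0 fun i => i.elim0).of_ringEquiv
        (RingEquiv.ofBijective (divisionCentralizer (Set.range Fin.elim0)).subtype
          ⟨Subtype.val_injective, fun d => ⟨⟨d, mem_divisionCentralizer_range.2
            fun i => i.elim0⟩, rfl⟩⟩)
    obtain ⟨a, u, hu0, hu⟩ := exists_eigenvector hD' T hT hM
    let V := eigenvectors (T 0) a
    have hTV : ∀ i, ∀ m ∈ V, T i m ∈ V := by
      intro i m hm
      rw [mem_eigenvectors] at hm ⊢
      rw [← map_smul, ← hm]
      exact LinearMap.congr_fun (hT 0 i) m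
    have : Nontrivial V := ⟨⟨u, hu⟩, 0, fun h => hu0 (congrArg Subtype.val h)⟩
    let T' : Fin n → Module.End (divisionCentralizer (Set.range fun _ : Fin 1 => a)) V := fun i =>
      { toFun := fun m => ⟨T i.succ m, hTV _ _ m.2⟩
        map_add' := fun x y => Subtype.ext (map_add (T i.succ) (x : M) y)
        map_smul' := fun c x => Subtype.ext (map_smul (T i.succ) (c : D) (x : M)) }
    -- The `D`-span of `W` is stable under `T 0` too, which acts on `W` as the scalar `a`;
    -- irreducibility over `D` then applies.
    have hspan : ∀ W : Submodule (divisionCentralizer (Set.range fun _ : Fin 1 => a)) M, W ≤ V →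
        (∀ i : Fin n, ∀ m ∈ W, T i.succ m ∈ W) → W ≠ ⊥ →
          Submodule.span D (W : Set M) = ⊤ := by
      intro W hWV hW hne
      refine (hM _ fun i m hm => ?_).resolve_left fun h => hne ?_
      · have hle : (Submodule.span D (W : Set M)).map (T i) ≤ Submodule.span D (W : Set M) := by
          rw [Submodule.map_span, Submodule.span_le]
          rintro _ ⟨w, hw, rfl⟩
          refine Fin.cases ?_ (fun i => ?_) i
          · rw [mem_eigenvectors.1 (hWV hw)]
            exact Submodule.smul_mem _ _ (Submodule.subset_span hw)
          · exact Submodule.subset_span (hW i w hw)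
        exact hle ⟨m, hm, rfl⟩
      · rw [eq_bot_iff]
        intro w hw
        have : w ∈ Submodule.span D (W : Set M) := Submodule.subset_span hw
        rwa [h, Submodule.mem_bot] at this
    have hirr : IsIrreducibleFamily T' := by
      intro W hW
      refine or_iff_not_imp_left.2 fun hne => ?_
      have hWV : W.map V.subtype ≤ V := by
        rintro _ ⟨w, _, rfl⟩
        exact w.2
      have htop := hspan (W.map V.subtype) hWV (by
        rintro i _ ⟨w, hw, rfl⟩
        exact ⟨_, hW i w hw, rfl⟩) fun h => hne (Submodule.map_injective_of_injective
          V.injective_subtype (h.trans (Submodule.map_bot _).symm))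
      rw [eq_top_iff]
      rintro x -
      have hx : (x : M) ∈ Submodule.span D (W.map V.subtype : Set M) := htop ▸ Submodule.mem_top
      obtain ⟨f, s, hs, -, hf⟩ := Submodule.mem_span_iff_exists_finset_subset.1 hx
      obtain ⟨w, hw, h⟩ := mem_of_mem_span_of_mem_eigenvectors (T 0) a hWV s hs x.2 f hf.symm
      exact Subtype.ext h ▸ hw
    obtain ⟨w, hw⟩ := ih (isCentrallyAC_divisionCentralizer hD a) T'
      (fun i j => LinearMap.ext fun m => Subtype.ext (LinearMap.congr_fun (hT i.succ j.succ) m))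
      hirr
    refine ⟨w, fun m => ?_⟩
    have hm : m ∈ Submodule.span D (V : Set M) := by
      rw [hspan V le_rfl (fun i => hTV _) fun h => hu0 ?_]
      · trivial
      · have huV : u ∈ V := hu
        rw [h] at huV
        exact (Submodule.mem_bot _).1 huV
    have hle : Submodule.span D (V : Set M) ≤ D ∙ (w : M) := by
      rw [Submodule.span_le]
      intro x hx
      obtain ⟨c, hc⟩ := hw ⟨x, hx⟩
      rw [show x = (c : D) • (w : M) from congrArg Subtype.val hc]
      exact Submodule.smul_mem _ _ (Submodule.mem_span_singleton_self _)
    obtain ⟨d, hd⟩ := Submodule.mem_span_singleton.1 (hle hm)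
    exact ⟨d, hd.symm⟩

/-! ### Cyclic modules over polynomials in several central variables. -/

namespace CentralPoly

variable {D : Type*} [DivisionRing D] {n : ℕ}

theorem const_mul (d : D) (p : CentralPoly D n) : const d * p = d • p := by
  induction p using AddMonoidAlgebra.induction_linear with
  | zero => simp
  | add p q hp hq => rw [mul_add, smul_add, hp, hq]
  | single γ c =>
    rw [const, AddMonoidAlgebra.single_mul_single, zero_add, AddMonoidAlgebra.smul_single,
      smul_eq_mul]

theorem var_mul (i : Fin n) (p : CentralPoly D n) : var D i * p = p * var D i := by
  induction p using AddMonoidAlgebra.induction_linear with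
  | zero => simp
  | add p q hp hq => rw [mul_add, add_mul, hp, hq]
  | single γ c =>
    rw [var, AddMonoidAlgebra.single_mul_single, AddMonoidAlgebra.single_mul_single, one_mul,
      mul_one, add_comm]

theorem const_zero : const (n := n) (0 : D) = 0 := AddMonoidAlgebra.single_zero 0

theorem const_one : const (n := n) (1 : D) = 1 := rfl

theorem const_mul_const (a b : D) : const (n := n) a * const b = const (a * b) := by
  rw [const, const, AddMonoidAlgebra.single_mul_single, zero_add, const]

theorem const_sub (a b : D) : const (n := n) (a - b) = const a - const b := by
  rw [eq_sub_iff_add_eq, const, const, ← AddMonoidAlgebra.single_add, sub_add_cancel, const]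

/-- A left ideal containing a nonzero constant is everything. -/
theorem eq_top_of_const_mem {I : Ideal (CentralPoly D n)} {d : D} (hd : d ≠ 0)
    (h : const d ∈ I) : I = ⊤ := by
  rw [Ideal.eq_top_iff_one]
  have := I.mul_mem_left (const d⁻¹) h
  rwa [const_mul_const, inv_mul_cancel₀ hd, const_one] at this

/-- Multiplication by an indeterminate on a cyclic module. -/
noncomputable def varEnd (I : Ideal (CentralPoly D n)) (i : Fin n) :
    Module.End D (CentralPoly D n ⧸ I) where
  toFun m := var D i • m
  map_add' := smul_add _
  map_smul' d m := by
    obtain ⟨p, rfl⟩ := I.mkQ_surjective m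
    change I.mkQ (var D i * (d • p)) = I.mkQ (d • (var D i * p))
    rw [← const_mul, ← const_mul, ← mul_assoc, ← mul_assoc, var_mul]

theorem commute_varEnd (I : Ideal (CentralPoly D n)) (i j : Fin n) :
    Commute (varEnd I i) (varEnd I j) := by
  ext m
  change var D i • var D j • m = var D j • var D i • m
  rw [smul_smul, smul_smul, var_mul]

theorem const_smul_quotient (I : Ideal (CentralPoly D n)) (d : D) (m : CentralPoly D n ⧸ I) :
    (const d : CentralPoly D n) • m = d • m := by
  obtain ⟨p, rfl⟩ := I.mkQ_surjective m
  change I.mkQ (const d * p) = I.mkQ (d • p)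
  rw [const_mul]

theorem smul_mem_of_invariant {I : Ideal (CentralPoly D n)}
    {N : Submodule D (CentralPoly D n ⧸ I)} (hN : ∀ i, ∀ m ∈ N, varEnd I i m ∈ N)
    (p : CentralPoly D n) : ∀ m ∈ N, p • m ∈ N := by
  have key : ∀ (γ : Fin n →₀ ℕ) (m), m ∈ N →
      (AddMonoidAlgebra.single γ 1 : CentralPoly D n) • m ∈ N := by
    intro γ
    induction γ using Finsupp.induction_linear with
    | zero =>
      intro m hm
      change (1 : CentralPoly D n) • m ∈ N
      rwa [one_smul]
    | add α β hα hβ =>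
      intro m hm
      have : (AddMonoidAlgebra.single (α + β) 1 : CentralPoly D n) =
          AddMonoidAlgebra.single α 1 * AddMonoidAlgebra.single β 1 := by
        rw [AddMonoidAlgebra.single_mul_single, one_mul]
      rw [this, mul_smul]
      exact hα _ (hβ m hm)
    | single i k =>
      have : (AddMonoidAlgebra.single (Finsupp.single i k) 1 : CentralPoly D n) = var D i ^ k := by
        rw [var, AddMonoidAlgebra.single_pow, one_pow, Finsupp.smul_single, smul_eq_mul, mul_one]
      rw [this]
      induction k with
      | zero => intro m hm; rwa [pow_zero, one_smul]
      | succ k ih =>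
        intro m hm
        rw [pow_succ, mul_smul]
        refine ih ?_ _ (hN i m hm)
        rw [var, AddMonoidAlgebra.single_pow, one_pow, Finsupp.smul_single, smul_eq_mul, mul_one]
  induction p using AddMonoidAlgebra.induction_linear with
  | zero => intro m _; rw [zero_smul]; exact zero_mem N
  | add p q hp hq => intro m hm; rw [add_smul]; exact add_mem (hp m hm) (hq m hm)
  | single γ c =>
    intro m hm
    have : (AddMonoidAlgebra.single γ c : CentralPoly D n) =
        const c * AddMonoidAlgebra.single γ 1 := by
      rw [const, AddMonoidAlgebra.single_mul_single, zero_add, mul_one]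
    rw [this, mul_smul, const_smul_quotient]
    exact N.smul_mem c (key γ m hm)

theorem isIrreducibleFamily_varEnd {I : Ideal (CentralPoly D n)} (hI : I.IsMaximal) :
    IsIrreducibleFamily (varEnd I) := by
  intro N hN
  have : IsSimpleModule (CentralPoly D n) (CentralPoly D n ⧸ I) :=
    isSimpleModule_iff_isCoatom.2 (Ideal.isMaximal_def.1 hI)
  let N' : Submodule (CentralPoly D n) (CentralPoly D n ⧸ I) :=
    { N.toAddSubmonoid with smul_mem' := fun p m hm => smul_mem_of_invariant hN p m hm }
  refine (eq_bot_or_eq_top N').imp (fun h => ?_) (fun h => ?_)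
  · ext m
    exact SetLike.ext_iff.1 h m
  · ext m
    exact SetLike.ext_iff.1 h m

/-- Since `I` is proper, the class of 1 is nonzero and so spans the line; the class of `xᵢ` is then
a scalar multiple of it. -/
theorem exists_var_sub_const_mem {I : Ideal (CentralPoly D n)} (hI : I ≠ ⊤)
    (h : ∃ v : CentralPoly D n ⧸ I, ∀ m, ∃ d : D, m = d • v) (i : Fin n) :
    ∃ c : D, var D i - const c ∈ I := by
  obtain ⟨v, hv⟩ := h
  obtain ⟨d, hd⟩ := hv (I.mkQ 1)
  have hd0 : d ≠ 0 := by
    rintro rfl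
    rw [zero_smul, Submodule.mkQ_apply, Submodule.Quotient.mk_eq_zero] at hd
    exact hI ((Ideal.eq_top_iff_one I).2 hd)
  obtain ⟨e, he⟩ := hv (I.mkQ (var D i))
  refine ⟨e * d⁻¹, (Submodule.Quotient.eq I).1 ?_⟩
  change I.mkQ (var D i) = I.mkQ (const (e * d⁻¹))
  rw [he, ← mul_one (const (e * d⁻¹)), const_mul]
  change _ = (e * d⁻¹) • I.mkQ 1
  rw [hd, smul_smul, mul_assoc, inv_mul_cancel₀ hd0, mul_one]

/-! ### Left evaluation at commuting points. -/

section Evaluation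

variable {E : Type*} [Ring E]

/-- Left evaluation at a tuple of pairwise commuting elements, with coefficients in `D` mapped
by `f`. -/
noncomputable def evalAt (f : D →+* E) (b : Fin n → E) (hb : ∀ i j, Commute (b i) (b j)) :
    CentralPoly D n →+ E :=
  AddMonoidAlgebra.liftNC f fun γ => commPow b hb (Multiplicative.ofAdd ⇑γ.toAdd)

variable {f : D →+* E} {b : Fin n → E} {hb : ∀ i j, Commute (b i) (b j)}

theorem evalAt_single (γ : Fin n →₀ ℕ) (c : D) :
    evalAt f b hb (AddMonoidAlgebra.single γ c) = f c * commPow b hb (Multiplicative.ofAdd ⇑γ) :=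
  AddMonoidAlgebra.liftNC_single _ _ _ _

/-- Left evaluation is not multiplicative: the monomial of a left factor lands on the right of the
value. Preimages of left ideals are therefore left ideals only under the stability required in
`evalComap`. -/
theorem evalAt_single_mul (γ : Fin n →₀ ℕ) (c : D) (q : CentralPoly D n) :
    evalAt f b hb (AddMonoidAlgebra.single γ c * q) =
      f c * evalAt f b hb q * commPow b hb (Multiplicative.ofAdd ⇑γ) := by
  induction q using AddMonoidAlgebra.induction_linear with
  | zero => simp
  | add p q hp hq => rw [mul_add, map_add, hp, hq, map_add, mul_add, add_mul]
  | single δ d =>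
    rw [AddMonoidAlgebra.single_mul_single, evalAt_single, evalAt_single, map_mul, add_comm γ,
      Finsupp.coe_add, ofAdd_add, map_mul]
    simp only [mul_assoc]

theorem evalAt_const (c : D) : evalAt f b hb (const c) = f c := by
  rw [const, evalAt_single, Finsupp.coe_zero, ofAdd_zero, map_one, mul_one]

theorem evalAt_one : evalAt f b hb 1 = 1 := by
  rw [← const_one, evalAt_const, map_one]

theorem evalAt_var (i : Fin n) : evalAt f b hb (var D i) = b i := by
  rw [var, evalAt_single, Finsupp.single_eq_pi_single, commPow_single, map_one, one_mul]

theorem evalAt_var_sub_const (i : Fin n) (c : D) :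
    evalAt f b hb (var D i - const c) = b i - f c := by
  rw [map_sub, evalAt_var, evalAt_const]

/-- The polynomials whose values lie in a given left ideal stable under right multiplication by
the point. -/
noncomputable def evalComap (f : D →+* E) (b : Fin n → E) (hb : ∀ i j, Commute (b i) (b j))
    (N : Ideal E) (hN : ∀ i, ∀ x ∈ N, x * b i ∈ N) : Ideal (CentralPoly D n) where
  carrier := {p | evalAt f b hb p ∈ N}
  add_mem' {p q} hp hq := by
    change evalAt f b hb (p + q) ∈ N
    rw [map_add]
    exact N.add_mem hp hq
  zero_mem' := by
    change evalAt f b hb 0 ∈ N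
    rw [map_zero]
    exact N.zero_mem
  smul_mem' p q hq := by
    change evalAt f b hb (p * q) ∈ N
    have key : ∀ (γ : Fin n →₀ ℕ), ∀ x ∈ N, x * commPow b hb (Multiplicative.ofAdd ⇑γ) ∈ N := by
      intro γ
      induction γ using Finsupp.induction_linear with
      | zero =>
        intro x hx
        rwa [Finsupp.coe_zero, ofAdd_zero, map_one, mul_one]
      | add α β hα hβ =>
        intro x hx
        rw [Finsupp.coe_add, ofAdd_add, map_mul, ← mul_assoc]
        exact hβ _ (hα x hx)
      | single i k =>
        have : Multiplicative.ofAdd (⇑(Finsupp.single i k) : Fin n → ℕ) =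
            Multiplicative.ofAdd (Pi.single i 1 : Fin n → ℕ) ^ k := by
          rw [← ofAdd_nsmul, Finsupp.single_eq_pi_single, ← Pi.single_smul, smul_eq_mul, mul_one]
        rw [this, map_pow, commPow_single]
        clear this
        induction k with
        | zero => intro x hx; rwa [pow_zero, mul_one]
        | succ k ih =>
          intro x hx
          rw [pow_succ, ← mul_assoc]
          exact hN i _ (ih x hx)
    induction p using AddMonoidAlgebra.induction_linear with
    | zero => rw [zero_mul, map_zero]; exact N.zero_mem
    | add p p' hp hp' => rw [add_mul, map_add]; exact N.add_mem hp hp'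
    | single γ c =>
      rw [evalAt_single_mul]
      exact key γ _ (N.mul_mem_left _ hq)

theorem mem_evalComap {N : Ideal E} {hN : ∀ i, ∀ x ∈ N, x * b i ∈ N} {p : CentralPoly D n} :
    p ∈ evalComap f b hb N hN ↔ evalAt f b hb p ∈ N := Iff.rfl

theorem evalAt_sum_var (i : Fin n) (p : D[X]) :
    evalAt f b hb (p.sum fun k c => const c * var D i ^ k) = p.eval₂ f (b i) := by
  have hpow : ∀ k : ℕ, evalAt f b hb (var D i ^ k) = b i ^ k := by
    intro k
    induction k with
    | zero => rw [pow_zero, pow_zero, evalAt_one]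
    | succ k ih =>
      rw [pow_succ, ← var_mul, var, evalAt_single_mul, ← var, ih, map_one, one_mul,
        Finsupp.single_eq_pi_single, commPow_single, pow_succ]
  rw [Polynomial.sum_def, map_sum, eval₂_eq_sum, Polynomial.sum_def]
  refine Finset.sum_congr rfl fun k _ => ?_
  rw [const, evalAt_single_mul, Finsupp.coe_zero, ofAdd_zero, map_one, mul_one, hpow]

end Evaluation

/-! ### Point ideals. -/

theorem evalAt_eq_zero_of_mem_pointIdeal {a : Fin n → D} (ha : ∀ i j, Commute (a i) (a j))
    {p : CentralPoly D n} (hp : p ∈ pointIdeal a) : evalAt (RingHom.id D) a ha p = 0 := by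
  have hle : pointIdeal a ≤ evalComap (RingHom.id D) a ha ⊥ (by simp) := by
    refine Ideal.span_le.2 ?_
    rintro _ ⟨i, rfl⟩
    change evalAt (RingHom.id D) a ha _ ∈ (⊥ : Ideal D)
    rw [evalAt_var_sub_const, RingHom.id_apply, sub_self]
    exact zero_mem _
  exact (Submodule.mem_bot D).1 (hle hp)

theorem pointIdeal_ne_top {a : Fin n → D} (ha : ∀ i j, Commute (a i) (a j)) :
    pointIdeal a ≠ ⊤ := by
  intro h
  have := evalAt_eq_zero_of_mem_pointIdeal ha ((Ideal.eq_top_iff_one _).1 h)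
  rw [evalAt_one] at this
  exact one_ne_zero this

/-- Modulo the point ideal `xᵢ` and `aᵢ` agree, so the `D`-line through 1 is stable under all
variables and hence under all polynomials. -/
theorem exists_sub_const_mem_pointIdeal (a : Fin n → D) (p : CentralPoly D n) :
    ∃ d : D, p - const d ∈ pointIdeal a := by
  let I := pointIdeal a
  let N : Submodule D (CentralPoly D n ⧸ I) := D ∙ I.mkQ 1
  have hconst : ∀ d : D, d • I.mkQ 1 = I.mkQ (const d) := fun d => by
    rw [← mul_one (const d), const_mul]
    rfl
  have hN : ∀ i, ∀ m ∈ N, varEnd I i m ∈ N := by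
    intro i m hm
    obtain ⟨d, rfl⟩ := Submodule.mem_span_singleton.1 hm
    rw [map_smul]
    refine N.smul_mem d ?_
    have h : varEnd I i (I.mkQ 1) = a i • I.mkQ 1 := by
      rw [hconst]
      change I.mkQ (var D i * 1) = _
      rw [mul_one]
      exact (Submodule.Quotient.eq I).2 (Ideal.subset_span ⟨i, rfl⟩)
    rw [h]
    exact N.smul_mem _ (Submodule.mem_span_singleton_self _)
  have h := smul_mem_of_invariant hN p _ (Submodule.mem_span_singleton_self _)
  obtain ⟨d, hd⟩ := Submodule.mem_span_singleton.1 h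
  refine ⟨d, (Submodule.Quotient.eq I).1 ?_⟩
  rw [hconst] at hd
  change I.mkQ p = I.mkQ (const d)
  rw [hd]
  change _ = I.mkQ (p * 1)
  rw [mul_one]

theorem pointIdeal_isMaximal {a : Fin n → D} (ha : ∀ i j, Commute (a i) (a j)) :
    (pointIdeal a).IsMaximal := by
  rw [Ideal.isMaximal_def]
  refine ⟨pointIdeal_ne_top ha, fun J hJ => ?_⟩
  obtain ⟨p, hpJ, hp⟩ := SetLike.exists_of_lt hJ
  obtain ⟨d, hd⟩ := exists_sub_const_mem_pointIdeal a p
  refine eq_top_of_const_mem (d := d) ?_ ?_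
  · rintro rfl
    rw [const_zero, sub_zero] at hd
    exact hp hd
  · have := J.sub_mem hpJ (hJ.le hd)
    rwa [sub_sub_cancel] at this

theorem exists_eq_pointIdeal {I : Ideal (CentralPoly D n)} (hI : I ≠ ⊤)
    (h : ∀ i, ∃ c : D, var D i - const c ∈ I) :
    ∃ a : Fin n → D, (∀ i j, Commute (a i) (a j)) ∧ I = pointIdeal a := by
  choose a ha using h
  have hcomm : ∀ i j, Commute (a i) (a j) := by
    intro i j
    by_contra hne
    -- The commutator of `xᵢ - aᵢ` and `xⱼ - aⱼ` is the constant `aᵢaⱼ - aⱼaᵢ`; a nonzero constant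
    -- cannot lie in a proper left ideal.
    have h1 := I.sub_mem (I.mul_mem_left (var D i - const (a i)) (ha j))
      (I.mul_mem_left (var D j - const (a j)) (ha i))
    have h2 : (var D i - const (a i)) * (var D j - const (a j)) -
        (var D j - const (a j)) * (var D i - const (a i)) = const (a i * a j - a j * a i) := by
      rw [const_sub, ← const_mul_const, ← const_mul_const]
      simp only [sub_mul, mul_sub]
      rw [var_mul i (var D j), var_mul i (const (a j)), var_mul j (const (a i))]
      abel
    rw [h2] at h1
    exact hI (eq_top_of_const_mem (sub_ne_zero.2 hne) h1)
  refine ⟨a, hcomm, ((pointIdeal_isMaximal hcomm).eq_of_le hI (Ideal.span_le.2 ?_)).symm⟩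
  rintro _ ⟨i, rfl⟩
  exact ha i

theorem incl_var {m : ℕ} (h : m ≤ n) (i : Fin m) :
    incl D h (var D i) = var D (Fin.castLE h i) := by
  simp [incl, var]

theorem incl_const {m : ℕ} (h : m ≤ n) (a : D) : incl D h (const a) = const a := by
  simp [incl, const]

theorem exists_permute (σ : Equiv.Perm (Fin n)) : ∃ e : CentralPoly D n ≃+* CentralPoly D n,
    (∀ i, e (var D i) = var D (σ i)) ∧ ∀ a : D, e (const a) = const a := by
  refine ⟨AddMonoidAlgebra.mapDomainRingEquiv D (Finsupp.domCongr σ), fun i => ?_, fun a => ?_⟩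
  · simp [var]
  · simp [const]

end CentralPoly

/-! ### The implications between the three conditions. -/

section Implications

open CentralPoly

variable {D : Type*} [DivisionRing D]

theorem IsNullstellensatzRing.isAmitsurSmallRing (h : IsNullstellensatzRing D) :
    IsAmitsurSmallRing D := by
  intro n I hI m hm
  obtain ⟨a, ha, rfl⟩ := (h n I).1 hI
  let a' : Fin m → D := fun i => a (Fin.castLE hm.le i)
  have hmax : (pointIdeal a').IsMaximal := pointIdeal_isMaximal fun i j => ha _ _
  have hle : pointIdeal a' ≤ (pointIdeal a).comap (incl D hm.le) := by
    refine Ideal.span_le.2 ?_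
    rintro _ ⟨i, rfl⟩
    change incl D hm.le (var D i - const (a' i)) ∈ pointIdeal a
    rw [map_sub, incl_var, incl_const]
    exact Ideal.subset_span ⟨Fin.castLE hm.le i, rfl⟩
  rwa [← hmax.eq_of_le (Ideal.comap_ne_top _ (pointIdeal_ne_top ha)) hle]

theorem IsCentrallyAC.isNullstellensatzRing (h : IsCentrallyAC D) : IsNullstellensatzRing D := by
  intro n I
  constructor
  · intro hI
    have : Nontrivial (CentralPoly D n ⧸ I) := Submodule.Quotient.nontrivial_iff.2 hI.ne_top
    exact exists_eq_pointIdeal hI.ne_top (exists_var_sub_const_mem hI.ne_top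
      (h.exists_forall_eq_smul n (varEnd I) (commute_varEnd I) (isIrreducibleFamily_varEnd hI)))
  · rintro ⟨a, ha, rfl⟩
    exact pointIdeal_isMaximal ha

/-- With a single operator, the line through an eigenvector is already invariant, hence everything.
-/
theorem IsRightAC.exists_var_sub_const_mem (hD : IsRightAC D) {I : Ideal (CentralPoly D 1)}
    (hI : I.IsMaximal) : ∃ c : D, var D 0 - const c ∈ I := by
  have : Nontrivial (CentralPoly D 1 ⧸ I) := Submodule.Quotient.nontrivial_iff.2 hI.ne_top
  have hirr := isIrreducibleFamily_varEnd hI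
  obtain ⟨a, u, hu0, hu⟩ := exists_eigenvector hD (varEnd I) (commute_varEnd I) hirr
  refine CentralPoly.exists_var_sub_const_mem hI.ne_top ⟨u, fun m => ?_⟩ 0
  have htop : D ∙ u = ⊤ := by
    refine (hirr (D ∙ u) fun i m hm => ?_).resolve_left (by simpa using hu0)
    obtain ⟨d, rfl⟩ := Submodule.mem_span_singleton.1 hm
    rw [map_smul, Fin.fin_one_eq_zero i, hu]
    exact Submodule.smul_mem _ _ (Submodule.smul_mem _ _ (Submodule.mem_span_singleton_self u))
  obtain ⟨d, hd⟩ := Submodule.mem_span_singleton.1 (htop ▸ Submodule.mem_top : m ∈ D ∙ u)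
  exact ⟨d, hd.symm⟩

theorem IsAmitsurSmallRing.isNullstellensatzRing (h : IsAmitsurSmallRing D) (hD : IsRightAC D) :
    IsNullstellensatzRing D := by
  intro n I
  refine ⟨fun hI => exists_eq_pointIdeal hI.ne_top fun i => ?_, ?_⟩
  · match n, I, hI, i with
    | 0, _, _, i => exact i.elim0
    | 1, I, hI, i =>
      rw [Fin.fin_one_eq_zero i]
      exact hD.exists_var_sub_const_mem hI
    | n + 2, I, hI, i =>
      -- Contraction reaches only initial variables, so `xᵢ` is first swapped into position 0.
      obtain ⟨e, hevar, heconst⟩ := exists_permute (D := D) (Equiv.swap 0 i)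
      have hI' : (I.comap e).IsMaximal := Ideal.comap_isMaximal_of_equiv e
      obtain ⟨c, hc⟩ := hD.exists_var_sub_const_mem (h (n + 2) (I.comap e) hI' 1 (by omega))
      refine ⟨c, ?_⟩
      change e (incl D _ (var D 0 - const c)) ∈ I at hc
      rw [map_sub, incl_var, incl_const, map_sub, hevar, heconst] at hc
      simpa using hc
  · rintro ⟨a, ha, rfl⟩
    exact pointIdeal_isMaximal ha

theorem IsNullstellensatzRing.isCentrallyAC (h : IsNullstellensatzRing D) : IsCentrallyAC D := by
  intro n a ha p hp
  let K := divisionCentralizer (Set.range a)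
  let P : D[X] := p.map K.subtype
  -- An extra variable, sent to `X`, will carry the root; the others are pinned to `a`.
  let b : Fin (n + 1) → D[X] := Fin.cons X fun i => C (a i)
  have hb : ∀ i j, Commute (b i) (b j) := by
    refine Fin.cases (Fin.cases (Commute.refl _) fun j => ?_) fun i =>
      Fin.cases ?_ fun j => ?_
    · exact commute_X _
    · exact (commute_X _).symm
    · change C (a i) * C (a j) = C (a j) * C (a i)
      rw [← C_mul, ← C_mul, (ha i j).eq]
  have hPa : ∀ i, P * C (a i) = C (a i) * P := by
    intro i
    ext k
    rw [coeff_mul_C, coeff_C_mul, coeff_map]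
    exact (mem_divisionCentralizer_range.1 (p.coeff k).2 i).symm
  -- The coefficients of `P` commute with each `a i`, so the left ideal of `P` is also stable under
  -- right multiplication by the `b i`.
  have hN : ∀ i, ∀ x ∈ Ideal.span {P}, x * b i ∈ Ideal.span {P} := by
    intro i x hx
    obtain ⟨r, rfl⟩ := Ideal.mem_span_singleton'.1 hx
    refine Fin.cases ?_ (fun i => ?_) i
    · refine Ideal.mem_span_singleton'.2 ⟨r * X, ?_⟩
      change _ = r * P * X
      rw [mul_assoc, mul_assoc, X_mul]
    · refine Ideal.mem_span_singleton'.2 ⟨r * C (a i), ?_⟩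
      change _ = r * P * C (a i)
      rw [mul_assoc, mul_assoc, hPa]
  let J : Ideal (CentralPoly D (n + 1)) := evalComap C b hb (Ideal.span {P}) hN
  have hJ : J ≠ ⊤ := by
    intro hJ
    have h1 : (1 : D[X]) ∈ Ideal.span {P} := by
      rw [← evalAt_one (f := C) (hb := hb)]
      exact mem_evalComap.1 (hJ ▸ Submodule.mem_top : (1 : CentralPoly D (n + 1)) ∈ J)
    obtain ⟨r, hr⟩ := Ideal.mem_span_singleton'.1 h1
    have hrP : r * P ≠ 0 := by rw [hr]; exact one_ne_zero
    have hdeg := natDegree_mul (left_ne_zero_of_mul hrP) (right_ne_zero_of_mul hrP)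
    have hPdeg : P.natDegree = p.natDegree := natDegree_map_eq_of_injective K.subtype.injective p
    rw [hr, natDegree_one] at hdeg
    omega
  obtain ⟨I, hI, hJI⟩ := Ideal.exists_le_maximal J hJ
  obtain ⟨c, hc, rfl⟩ := (h (n + 1) I).1 hI
  have hca : ∀ i : Fin n, c i.succ = a i := by
    intro i
    have hmem : var D i.succ - const (a i) ∈ J := by
      rw [mem_evalComap, evalAt_var_sub_const]
      change C (a i) - C (a i) ∈ _
      rw [sub_self]
      exact zero_mem _
    have := evalAt_eq_zero_of_mem_pointIdeal hc (hJI hmem)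
    rwa [evalAt_var_sub_const, RingHom.id_apply, sub_eq_zero] at this
  have hroot : P.eval (c 0) = 0 := by
    have hmem : (P.sum fun k d => const d * var D (0 : Fin (n + 1)) ^ k) ∈ J := by
      rw [mem_evalComap, evalAt_sum_var]
      change P.eval₂ C X ∈ _
      rw [eval₂_C_X]
      exact Ideal.mem_span_singleton_self P
    have := evalAt_eq_zero_of_mem_pointIdeal hc (hJI hmem)
    rwa [evalAt_sum_var] at this
  have hc0 : c 0 ∈ K := mem_divisionCentralizer_range.2 fun i => by
    rw [← hca]
    exact hc i.succ 0
  refine ⟨⟨c 0, hc0⟩, Subtype.ext ?_⟩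
  have h2 : K.subtype (p.eval ⟨c 0, hc0⟩) = P.eval (c 0) := by
    rw [eval_map, ← eval₂_id, hom_eval₂, RingHom.comp_id]
    rfl
  exact h2.trans hroot

end Implications

theorem mainTheorem7 (D : Type*) [DivisionRing D] (hD : IsRightAC D) :
    List.TFAE [IsNullstellensatzRing D, IsAmitsurSmallRing D, IsCentrallyAC D] := by
  tfae_have 1 → 2 := IsNullstellensatzRing.isAmitsurSmallRing
  tfae_have 2 → 1 := fun h => h.isNullstellensatzRing hD
  tfae_have 1 → 3 := IsNullstellensatzRing.isCentrallyAC
  tfae_have 3 → 1 := IsCentrallyAC.isNullstellensatzRing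
  tfae_finish
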